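/- For a commutative ring $R$ and an integer $m\ge 0$ let $H_m(R)$ be the group of all matrices $\begin{bmatrix}1&u&s\\0&I_m&v^t\\0&0&1\end{bmatrix}$ with $s\in R$ and $u,v\in R^m$. A group is a generalized Heisenberg group if it is isomorphic to $H_m(K)$ for some field $K$ and some $m$. Write $Z(G)$ for the center and $G'$ for the commutator subgroup of a group $G$. For a group $G$ of nilpotency class $2$ (that is, $1<G'\le Z(G)<G$) let $b_G: G/Z(G)\times G/Z(G)\to G'$, $b_G(Z(G)x,Z(G)y)=[x,y]$, which is a biadditive map of (additively written) abelian groups, and let $$\mathrm{Adj}(b_G)=\{(f,g)\in \mathrm{End}(G/Z(G))\times \mathrm{End}(G/Z(G))^{op} : b_G(f(u),v)=b_G(u,g(v))\ \text{for all } u,v\in G/Z(G)\},$$ a ring acting on $G/Z(G)$ through the first component. If $G$ is a nonabelian quotient of a generalized Heisenberg group of odd order, then $G'=Z(G)$ and the center $k$ of $\mathrm{Adj}(b_G)$ is a field over which $G/Z(G)$ has some even dimension $2m$; put $\lfloor G\rfloor=H_m(k)$. For a generalized Heisenberg group $H$ of odd order and a proper subgroup $N<H'$ (such an $N$ is normal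 in $H$ and $H/N$ is nonabelian), the quotient $H/N$ is called indigenous to $H$ if $H\cong\lfloor H/N\rfloor$. **Theorem.** Let $H$ be a generalized Heisenberg group of (finite) odd order, and let $M$ and $N$ be proper subgroups of $H'$ such that $H/M$ and $H/N$ are indigenous to $H$. Then every isomorphism $\varphi:H/M\to H/N$ is induced by an automorphism of $H$: there is an automorphism $\Phi$ of $H$ with $\Phi(M)=N$ and $\varphi(xM)=\Phi(x)N$ for all $x\in H$. -/

import Mathlib

namespace GenHeis

universe u

section Matrices

variable {m : ℕ} {R : Type u} [CommRing R]

/-- The block matrix with rows `(1, u, s)`, `(0, I_m, vᵗ)`, `(0, 0, 1)`. -/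
def heisMatrix (x y : Fin m → R) (s : R) :
    Matrix (Unit ⊕ (Fin m ⊕ Unit)) (Unit ⊕ (Fin m ⊕ Unit)) R :=
  Matrix.fromBlocks 1
    (Matrix.fromCols (Matrix.replicateRow Unit x) (Matrix.of fun _ _ => s))
    0
    (Matrix.fromBlocks 1 (Matrix.replicateCol Unit y) 0 1)

theorem heisMatrix_mul (x y x' y' : Fin m → R) (s s' : R) :
    heisMatrix x y s * heisMatrix x' y' s'
      = heisMatrix (x + x') (y + y') (s + s' + x ⬝ᵥ y') := by
  ext i j
  rcases i with i | i | i <;> rcases j with j | j | j <;>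
    simp [heisMatrix, Matrix.mul_apply, Matrix.one_apply, dotProduct, add_comm, add_left_comm,
      add_assoc]

theorem heisMatrix_zero : heisMatrix (0 : Fin m → R) 0 0 = 1 := by
  ext i j
  rcases i with i | i | i <;> rcases j with j | j | j <;>
    simp [heisMatrix, Matrix.one_apply]

end Matrices

/-- The group `H_m(R)` of all matrices `heisMatrix u v s` with `u, v ∈ R^m` and `s ∈ R`,
under matrix multiplication. -/
def heis (m : ℕ) (R : Type u) [CommRing R] :
    Subgroup (Matrix.GeneralLinearGroup (Unit ⊕ (Fin m ⊕ Unit)) R) where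
  carrier := {g | ∃ (x y : Fin m → R) (s : R), g.val = heisMatrix x y s}
  one_mem' := ⟨0, 0, 0, by rw [heisMatrix_zero]; rfl⟩
  mul_mem' := by
    rintro a b ⟨x, y, s, ha⟩ ⟨x', y', s', hb⟩
    exact ⟨x + x', y + y', s + s' + x ⬝ᵥ y', by
      rw [Units.val_mul, ha, hb, heisMatrix_mul]⟩
  inv_mem' := by
    rintro a ⟨x, y, s, ha⟩
    refine ⟨-x, -y, -s + x ⬝ᵥ y, ?_⟩
    refine Units.inv_eq_of_mul_eq_one_right ?_
    rw [ha, heisMatrix_mul, ← heisMatrix_zero]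
    congr 1 <;> simp

/-- `H` is a generalized Heisenberg group: it is isomorphic to `H_m(K)` for some field `K` and
some `m`. (Since `K` embeds in `H_m(K)`, the universe of `K` is no restriction.) -/
def IsGenHeisenberg (H : Type u) [Group H] : Prop :=
  ∃ (K : Type u) (_ : Field K) (m : ℕ), Nonempty (H ≃* heis m K)

/-- `G` is nilpotent of class two: `1 < G' ≤ Z(G)` (and so `Z(G) < G`). -/
class IsClassTwo (G : Type u) [Group G] : Prop where
  commutator_ne_bot : commutator G ≠ ⊥
  commutator_le_center : commutator G ≤ Subgroup.center G

open scoped commutatorElement in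
theorem comm_mem {G : Type u} [Group G] (x y : G) : x⁻¹ * y⁻¹ * x * y ∈ commutator G := by
  have h : ⁅x⁻¹, y⁻¹⁆ ∈ commutator G :=
    Subgroup.commutator_mem_commutator (Subgroup.mem_top _) (Subgroup.mem_top _)
  simpa [commutatorElement_def] using h

section ClassTwo

variable (G : Type u) [Group G] [IsClassTwo G]

instance quotientCenterCommGroup : CommGroup (G ⧸ Subgroup.center G) where
  mul_comm a b := by
    induction a using QuotientGroup.induction_on with | H x => ?_
    induction b using QuotientGroup.induction_on with | H y => ?_
    rw [← QuotientGroup.mk_mul, ← QuotientGroup.mk_mul, QuotientGroup.eq]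
    simpa [mul_assoc] using IsClassTwo.commutator_le_center (comm_mem y x)

instance commutatorCommGroup : CommGroup (commutator G) where
  mul_comm a b := Subtype.ext
    (Subgroup.mem_center_iff.1 (IsClassTwo.commutator_le_center b.2) a.1)

/-- `G/Z(G)`, written additively. -/
abbrev V : Type u := Additive (G ⧸ Subgroup.center G)

/-- `G'`, written additively. -/
abbrev W : Type u := Additive (commutator G)

variable {G}

/-- The commutator `[x, y] = x⁻¹ y⁻¹ x y` as an element of `G'`. -/
def comm (x y : G) : commutator G := ⟨x⁻¹ * y⁻¹ * x * y, comm_mem x y⟩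

theorem comm_mul_left (x x' y : G) : comm (x * x') y = comm x y * comm x' y := by
  have h := Subgroup.mem_center_iff.1 (IsClassTwo.commutator_le_center (comm_mem x y)) x'⁻¹
  apply Subtype.ext
  change (x * x')⁻¹ * y⁻¹ * (x * x') * y = (x⁻¹ * y⁻¹ * x * y) * (x'⁻¹ * y⁻¹ * x' * y)
  calc (x * x')⁻¹ * y⁻¹ * (x * x') * y
      = (x'⁻¹ * (x⁻¹ * y⁻¹ * x * y)) * (y⁻¹ * x' * y) := by group
    _ = (x⁻¹ * y⁻¹ * x * y) * (x'⁻¹ * y⁻¹ * x' * y) := by rw [h]; group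

theorem comm_inv (x y : G) : (comm x y)⁻¹ = comm y x := by
  apply Subtype.ext
  change (x⁻¹ * y⁻¹ * x * y)⁻¹ = y⁻¹ * x⁻¹ * y * x
  group

theorem comm_mul_right (x y y' : G) : comm x (y * y') = comm x y * comm x y' := by
  rw [← comm_inv (y * y') x, comm_mul_left, mul_inv, comm_inv, comm_inv]

theorem comm_center_left (z y : G) (hz : z ∈ Subgroup.center G) : comm z y = 1 := by
  have h := Subgroup.mem_center_iff.1 hz y
  apply Subtype.ext
  change z⁻¹ * y⁻¹ * z * y = 1
  rw [mul_assoc, ← h]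
  group

theorem comm_congr (x x' y y' : G) (hx : (x : G ⧸ Subgroup.center G) = x')
    (hy : (y : G ⧸ Subgroup.center G) = y') : comm x y = comm x' y' := by
  have hl : ∀ a b c : G, (a : G ⧸ Subgroup.center G) = b → comm a c = comm b c := by
    intro a b c hab
    have h := comm_mul_left a (a⁻¹ * b) c
    rw [comm_center_left _ _ (QuotientGroup.eq.1 hab), mul_one, mul_inv_cancel_left] at h
    exact h.symm
  rw [hl x x' y hx, ← comm_inv, hl y y' x' hy, comm_inv]

variable (G) in
/-- The commutation bimap `Bi(G) : G/Z(G) × G/Z(G) → G'`, `(Z(G)x, Z(G)y) ↦ [x, y]`. -/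
def Bi : V G →+ V G →+ W G :=
  AddMonoidHom.mk'
    (fun a => AddMonoidHom.mk'
      (fun b => Additive.ofMul (Quotient.liftOn₂' a.toMul b.toMul comm
        (fun x y x' y' hx hy => comm_congr x x' y y' (Quotient.sound' hx) (Quotient.sound' hy))))
      (by
        intro b b'
        induction a using Additive.rec with | ofMul a => ?_
        induction b using Additive.rec with | ofMul b => ?_
        induction b' using Additive.rec with | ofMul b' => ?_
        induction a using QuotientGroup.induction_on with | H x => ?_
        induction b using QuotientGroup.induction_on with | H y => ?_
        induction b' using QuotientGroup.induction_on with | H y' => ?_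
        exact congrArg Additive.ofMul (comm_mul_right x y y')))
    (by
      intro a a'
      refine AddMonoidHom.ext fun b => ?_
      induction a using Additive.rec with | ofMul a => ?_
      induction a' using Additive.rec with | ofMul a' => ?_
      induction b using Additive.rec with | ofMul b => ?_
      induction a using QuotientGroup.induction_on with | H x => ?_
      induction a' using QuotientGroup.induction_on with | H x' => ?_
      induction b using QuotientGroup.induction_on with | H y => ?_
      exact congrArg Additive.ofMul (comm_mul_left x x' y))

theorem Bi_mk (x y : G) :
    Bi G (Additive.ofMul (x : G ⧸ Subgroup.center G)) (Additive.ofMul (y : G ⧸ Subgroup.center G))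
      = Additive.ofMul (comm x y) := rfl

end ClassTwo

section Adjoints

variable {A B : Type u} [AddCommGroup A] [AddCommGroup B]

/-- The adjoint ring of a bimap `b : A × A → B`: all pairs `(f, g)` in `End A × (End A)ᵒᵖ` with
`b (f u, v) = b (u, g v)`. -/
def Adj (b : A →+ A →+ B) : Subring (AddMonoid.End A × (AddMonoid.End A)ᵐᵒᵖ) where
  carrier := {p | ∀ x y : A, b (p.1 x) y = b x (p.2.unop y)}
  zero_mem' := by intro x y; simp
  one_mem' := by intro x y; simp
  add_mem' := by
    intro p q hp hq x y
    change b (p.1 x + q.1 x) y = b x (p.2.unop y + q.2.unop y)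
    rw [map_add, map_add, AddMonoidHom.add_apply, hp x y, hq x y]
  neg_mem' := by
    intro p hp x y
    change b (-p.1 x) y = b x (-p.2.unop y)
    rw [map_neg, map_neg, AddMonoidHom.neg_apply, hp x y]
  mul_mem' := by
    intro p q hp hq x y
    change b (p.1 (q.1 x)) y = b x (q.2.unop (p.2.unop y))
    rw [hp, hq]

/-- The center of the adjoint ring, a commutative ring. -/
def AdjCenter (b : A →+ A →+ B) : Type u := Subring.center (Adj b)

instance adjCenterCommRing (b : A →+ A →+ B) : CommRing (AdjCenter b) :=
  inferInstanceAs (CommRing (Subring.center (Adj b)))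

/-- The first component of an element of the center of the adjoint ring. -/
def adjCenterFst (b : A →+ A →+ B) : AdjCenter b →+* AddMonoid.End A :=
  (RingHom.fst _ _).comp ((Adj b).subtype.comp (Subring.center (Adj b)).subtype)

/-- The action of the center of the adjoint ring on `A`, through the first component. -/
instance adjCenterModule (b : A →+ A →+ B) : Module (AdjCenter b) A :=
  Module.compHom A (adjCenterFst b)

theorem adjCenter_smul_def (b : A →+ A →+ B) (p : AdjCenter b) (x : A) :
    p • x = (p.1.1.1 : AddMonoid.End A) x := rfl

end Adjoints

/-- `H ≅ ⌊G⌋`, where `⌊G⌋ = H_m(k)` for `k` the center of `Adj(Bi(G))` and `2m` the dimension of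
`G/Z(G)` over `k`. (If `G` is a nonabelian quotient of a generalized Heisenberg group of odd order,
then `k` is a field and `Z(G) = G'`.) -/
def IsoFloor (H G : Type u) [Group H] [Group G] [IsClassTwo G] : Prop :=
  ∃ m : ℕ, Module.finrank (AdjCenter (Bi G)) (V G) = 2 * m ∧
    Nonempty (H ≃* heis m (AdjCenter (Bi G)))

/-- `H/N` is indigenous to `H`: it is nilpotent of class two and `H ≅ ⌊H/N⌋`. -/
def IsIndigenous (H : Type u) [Group H] (N : Subgroup H) [N.Normal] : Prop :=
  ∃ _ : IsClassTwo (H ⧸ N), IsoFloor H (H ⧸ N)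

end GenHeis

/-! In odd order, halving the corner entry identifies `H` with `V × K`, with commutators given by a
nondegenerate alternating form `B`; `M` and `N` become proper additive subgroups of `K`, and `H/M`
has commutation bimap `B` mod `M`.

The rank one maps `u ↦ B(u,a) b` have exact adjoints `v ↦ B(b,v) a`, so they lie in the adjoint ring
of `B` mod `M`. Commuting with them forces each central element to be a scalar, so the center `k`
embeds in `K`. Indigeneity gives `|K| ≤ |H'| = |H_m(k)'| ≤ |k|`, hence `k = K`, and every adjoint
pair mod `M` is `K`-linear (`map_smul_of_card_adjCenter`).

An isomorphism `H/M ≃ H/N` induces an additive bijection `P` of `V` carrying `B` mod `M` to `B` mod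
`N`. Conjugating rank one maps by `P` shows that `P` is `σ`-semilinear, and properness of `N`
upgrades the congruence to `B(Pu,Pv) = l σ(B(u,v))` (`exists_semisimilarity`). The lift is `(u,s) ↦
(Pu, l σ(s) + g(τ(u)))`: the additive map `τ : V → K/N` records the central part of the isomorphism,
and `g` is an additive section of `K → K/N` (`exists_lift_of_semisimilarity`). -/

namespace GenHeis

universe u

/-! ### Adjoint pairs of a form modulo an additive subgroup. -/

section LinearAlgebra

variable {K V : Type u} [Field K] [AddCommGroup V] [Module K V]

/-- A proper additive subgroup of a field contains no nonzero ideal. -/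
theorem eq_zero_of_mul_mem {N : AddSubgroup K} (hN : N ≠ ⊤) {a : K} (h : ∀ c : K, c * a ∈ N) :
    a = 0 := by
  by_contra ha
  refine hN ((AddSubgroup.eq_top_iff' N).2 fun s => ?_)
  have := h (s * a⁻¹)
  rwa [mul_assoc, inv_mul_cancel₀ ha, mul_one] at this

/-- The rank one endomorphism `u ↦ B(u, a) b`. -/
def rankOne (B : V →ₗ[K] V →ₗ[K] K) (a b : V) : V →+ V :=
  AddMonoidHom.mk' (fun u => B u a • b) (by intro u v; simp [add_smul])

/-- The adjoint `v ↦ B(b, v) a` of `rankOne B a b`. -/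
def rankOneAdj (B : V →ₗ[K] V →ₗ[K] K) (a b : V) : V →+ V :=
  AddMonoidHom.mk' (fun v => B b v • a) (by intro u v; simp [add_smul])

@[simp]
theorem rankOne_apply (B : V →ₗ[K] V →ₗ[K] K) (a b u : V) : rankOne B a b u = B u a • b := rfl

@[simp]
theorem rankOneAdj_apply (B : V →ₗ[K] V →ₗ[K] K) (a b v : V) :
    rankOneAdj B a b v = B b v • a := rfl

theorem rankOne_adjoint (B : V →ₗ[K] V →ₗ[K] K) (a b u v : V) :
    B (rankOne B a b u) v = B u (rankOneAdj B a b v) := by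
  simp [mul_comm]

/-- An additive map commuting with all rank one endomorphisms is a scalar. -/
theorem exists_smul_of_commute_rankOne {B : V →ₗ[K] V →ₗ[K] K} {u₀ a₀ : V} (h1 : B u₀ a₀ = 1)
    (f : V →+ V) (hf : ∀ a b u, f (rankOne B a b u) = rankOne B a b (f u)) :
    ∃ c : K, ∀ w, f w = c • w :=
  -- As `B u₀ a₀ = 1`, the vector `w` is the image of `u₀` under `rankOne B a₀ w`; commute `f` past
  -- it.
  ⟨B (f u₀) a₀, fun w => by simpa [h1] using hf a₀ w u₀⟩

/-- If the center of the adjoint ring of `B mod M` is as large as `K`, then every adjoint pair of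
`B mod M` is `K`-linear. -/
theorem map_smul_of_card_adjCenter [Finite K] {A C : Type u} [AddCommGroup A] [AddCommGroup C]
    {B : V →ₗ[K] V →ₗ[K] K} {u₀ a₀ : V} (h1 : B u₀ a₀ = 1) {M : AddSubgroup K}
    (b : A →+ A →+ C) (hb : ∀ y, (∀ x, b x y = 0) → y = 0) (θ : A ≃+ V)
    (hθ : ∀ x y x' y', b x y = b x' y' ↔ B (θ x) (θ y) - B (θ x') (θ y') ∈ M)
    (hcard : Finite (AdjCenter b) → Nat.card K ≤ Nat.card (AdjCenter b))
    (f g : V →+ V) (hfg : ∀ u v, B (f u) v - B u (g v) ∈ M) (c : K) (u : V) :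
    f (c • u) = c • f u := by
  let conj : (V →+ V) → AddMonoid.End A := fun f =>
    (θ.symm.toAddMonoidHom.comp f).comp θ.toAddMonoidHom
  have hconj : ∀ f x, θ (conj f x) = f (θ x) := fun f x => θ.apply_symm_apply _
  have hadj : ∀ f g : V →+ V, (∀ u v, B (f u) v - B u (g v) ∈ M) →
      (conj f, MulOpposite.op (conj g)) ∈ Adj b := by
    intro f g h x y
    change b (conj f x) y = b x (conj g y)
    rw [hθ, hconj, hconj]
    exact h _ _
  have hcomm : ∀ (p : AdjCenter b) (f g : V →+ V), (∀ u v, B (f u) v - B u (g v) ∈ M) →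
      ∀ x, conj f ((p.1.1.1 : AddMonoid.End A) x) = (p.1.1.1 : AddMonoid.End A) (conj f x) := by
    intro p f g h x
    have := Subring.mem_center_iff.1 p.2 ⟨_, hadj f g h⟩
    exact DFunLike.congr_fun (congrArg (fun q : Adj b => q.1.1) this) x
  have hex : ∀ p : AdjCenter b, ∃ c : K, ∀ x, θ ((p.1.1.1 : AddMonoid.End A) x) = c • θ x := by
    intro p
    obtain ⟨c, hc⟩ := exists_smul_of_commute_rankOne h1
      ((θ.toAddMonoidHom.comp (p.1.1.1 : AddMonoid.End A)).comp θ.symm.toAddMonoidHom)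
      (fun a b' u => by
        have h := hcomm p (rankOne B a b') (rankOneAdj B a b')
          (fun u v => by rw [rankOne_adjoint, sub_self]; exact M.zero_mem) (θ.symm u)
        have h' := congrArg θ h
        rw [hconj] at h'
        have h2 : conj (rankOne B a b') (θ.symm u) = θ.symm (rankOne B a b' u) := by
          apply θ.injective
          rw [hconj, θ.apply_symm_apply, θ.apply_symm_apply]
        rw [h2] at h'
        exact h'.symm)
    refine ⟨c, fun x => ?_⟩
    have h : θ ((p.1.1.1 : AddMonoid.End A) (θ.symm (θ x))) = c • θ x := hc (θ x)
    rwa [θ.symm_apply_apply] at h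
  choose κ hκ using hex
  have hinj : Function.Injective κ := by
    intro p q hpq
    have hfst : ∀ x, (p.1.1.1 : AddMonoid.End A) x = (q.1.1.1 : AddMonoid.End A) x := fun x =>
      θ.injective (by rw [hκ, hκ, hpq])
    refine Subtype.ext (Subtype.ext (Prod.ext (AddMonoidHom.ext hfst) ?_))
    apply MulOpposite.unop_injective
    refine AddMonoidHom.ext fun y => ?_
    -- By nondegeneracy the first component of an adjoint pair determines the second.
    refine sub_eq_zero.1 (hb _ fun x => ?_)
    rw [map_sub, sub_eq_zero]
    exact (p.1.2 x y).symm.trans ((congrArg (fun z => b z y) (hfst x)).trans (q.1.2 x y))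
  have hfin : Finite (AdjCenter b) := Finite.of_injective κ hinj
  have hsurj : Function.Surjective κ :=
    ((Nat.bijective_iff_injective_and_card κ).2
      ⟨hinj, le_antisymm (Nat.card_le_card_of_injective κ hinj) (hcard hfin)⟩).2
  -- Every scalar now comes from the center, which commutes with the adjoint pair of `f`.
  obtain ⟨p, rfl⟩ := hsurj c
  have h := congrArg θ (hcomm p f g hfg (θ.symm u))
  rw [hconj, hκ, hκ, hconj, θ.apply_symm_apply] at h
  exact h

/-- An additive bijection that is compatible with `B` modulo `M` and modulo `N` is semilinear, and a
semisimilarity of `B`. -/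
theorem exists_semisimilarity [Finite K] {B : V →ₗ[K] V →ₗ[K] K} {u₀ a₀ : V}
    (h1 : B u₀ a₀ = 1) {M N : AddSubgroup K} (hN : N ≠ ⊤)
    (hlin : ∀ f g : V →+ V, (∀ u v, B (f u) v - B u (g v) ∈ M) →
      ∀ (c : K) (u : V), f (c • u) = c • f u)
    (φ : V ≃+ V)
    (hφ : ∀ u v u' v', B u v - B u' v' ∈ M ↔ B (φ u) (φ v) - B (φ u') (φ v') ∈ N) :
    ∃ (σ : K →+* K) (l : K), l ≠ 0 ∧ ∀ u v, B (φ u) (φ v) = l * σ (B u v) := by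
  have hu : u₀ ≠ 0 := by rintro rfl; simp at h1
  have hσ : ∀ c : K, ∃ d : K, ∀ u, φ (c • u) = d • φ u := by
    intro c
    obtain ⟨d, hd⟩ := exists_smul_of_commute_rankOne h1
      (AddMonoidHom.mk' (fun w => φ (c • φ.symm w)) (by intro x y; simp))
      (fun a b w => by
        -- Conjugating an exact adjoint pair by `φ` gives an adjoint pair mod `M`, so it commutes
        -- with `c`.
        have h := hlin
          ((φ.symm.toAddMonoidHom.comp (rankOne B a b)).comp φ.toAddMonoidHom)
          ((φ.symm.toAddMonoidHom.comp (rankOneAdj B a b)).comp φ.toAddMonoidHom)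
          (fun u v => by
            rw [hφ]
            simp [mul_comm]) c (φ.symm w)
        have h' := congrArg φ h
        simp at h'
        simpa using h'.symm)
    refine ⟨d, fun u => ?_⟩
    simpa using hd (φ u)
  choose σ hσ using hσ
  have hφu : φ u₀ ≠ 0 := by simpa using hu
  have huniq : ∀ c d : K, c • φ u₀ = d • φ u₀ → c = d := fun c d h => smul_left_injective K hφu h
  let S : K →+* K :=
    { toFun := σ
      map_one' := huniq _ _ (by rw [← hσ, one_smul, one_smul])
      map_mul' := fun c d => huniq _ _ (by rw [← hσ, mul_smul, mul_smul, hσ, hσ])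
      map_zero' := huniq _ _ (by rw [← hσ, zero_smul, zero_smul, map_zero])
      map_add' := fun c d => huniq _ _ (by rw [← hσ, add_smul, add_smul, map_add, hσ, hσ]) }
  have hS : ∀ c u, φ (c • u) = S c • φ u := hσ
  have hsurj : Function.Surjective S := Finite.surjective_of_injective S.injective
  have hsim : ∀ u v, B (φ u) (φ v) = B (φ u₀) (φ a₀) * S (B u v) := by
    intro b v
    have hz : B (φ b) (φ v) - B (φ u₀) (φ a₀) * S (B b v) = 0 := by
      refine eq_zero_of_mul_mem hN fun c => ?_
      obtain ⟨d, rfl⟩ := hsurj c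
      -- The identity `B(d b, v) = B(d u₀, B(b,v) a₀)`, transported by `φ`, puts the `S d`-multiple
      -- of the defect in `N`.
      have h := (hφ (rankOne B a₀ b (d • u₀)) v (d • u₀) (rankOneAdj B a₀ b v)).1
        (by rw [rankOne_adjoint, sub_self]; exact M.zero_mem)
      simp only [rankOne_apply, rankOneAdj_apply, hS, map_smul, LinearMap.smul_apply, smul_eq_mul,
        h1, mul_one] at h
      convert h using 1
      ring
    exact sub_eq_zero.1 hz
  refine ⟨S, _, fun h0 => ?_, hsim⟩
  have := hsim (φ.symm u₀) (φ.symm a₀)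
  rw [h0, zero_mul] at this
  simp [h1] at this

end LinearAlgebra

/-! ### Entries and multiplication in `H_m(R)`. -/

section Heis

variable {m : ℕ} {R : Type u} [CommRing R]

/-- The element `heisMatrix x y s` of `H_m(R)`. -/
def heisMk (x y : Fin m → R) (s : R) : heis m R :=
  ⟨⟨heisMatrix x y s, heisMatrix (-x) (-y) (-s + x ⬝ᵥ y),
    by rw [heisMatrix_mul, ← heisMatrix_zero]; congr 1 <;> simp,
    by rw [heisMatrix_mul, ← heisMatrix_zero]; congr 1 <;> simp⟩, x, y, s, rfl⟩

/-- The row `u` of an element of `H_m(R)`. -/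
def heisRow (g : heis m R) : Fin m → R := fun i => g.1.val (Sum.inl ()) (Sum.inr (Sum.inl i))

/-- The column `v` of an element of `H_m(R)`. -/
def heisCol (g : heis m R) : Fin m → R :=
  fun i => g.1.val (Sum.inr (Sum.inl i)) (Sum.inr (Sum.inr ()))

/-- The corner entry of an element of `H_m(R)`. -/
def heisCorner (g : heis m R) : R := g.1.val (Sum.inl ()) (Sum.inr (Sum.inr ()))

@[simp]
theorem heisRow_mk (x y : Fin m → R) (s : R) : heisRow (heisMk x y s) = x := rfl

@[simp]
theorem heisCol_mk (x y : Fin m → R) (s : R) : heisCol (heisMk x y s) = y := rfl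

@[simp]
theorem heisCorner_mk (x y : Fin m → R) (s : R) : heisCorner (heisMk x y s) = s := rfl

theorem heisMk_eta (g : heis m R) : heisMk (heisRow g) (heisCol g) (heisCorner g) = g := by
  obtain ⟨g, x, y, s, h⟩ := g
  obtain rfl : g = (heisMk x y s).1 := Units.ext h
  rfl

theorem heisMk_mul (x y x' y' : Fin m → R) (s s' : R) :
    heisMk x y s * heisMk x' y' s' = heisMk (x + x') (y + y') (s + s' + x ⬝ᵥ y') :=
  Subtype.ext (Units.ext (heisMatrix_mul x y x' y' s s'))

theorem heisRow_mul (g h : heis m R) : heisRow (g * h) = heisRow g + heisRow h := by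
  conv_lhs => rw [← heisMk_eta g, ← heisMk_eta h, heisMk_mul]
  rfl

theorem heisCol_mul (g h : heis m R) : heisCol (g * h) = heisCol g + heisCol h := by
  conv_lhs => rw [← heisMk_eta g, ← heisMk_eta h, heisMk_mul]
  rfl

theorem heisCorner_mul (g h : heis m R) :
    heisCorner (g * h) = heisCorner g + heisCorner h + heisRow g ⬝ᵥ heisCol h := by
  conv_lhs => rw [← heisMk_eta g, ← heisMk_eta h, heisMk_mul]
  rfl

/-- The abelian quotient map `H_m(R) → R^m × R^m`. -/
def heisProj : heis m R →* Multiplicative ((Fin m → R) × (Fin m → R)) :=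
  MonoidHom.mk' (fun g => Multiplicative.ofAdd (heisRow g, heisCol g))
    (fun g h => by rw [heisRow_mul, heisCol_mul]; rfl)

/-- Commutators die in the abelian quotient, so only the corner entry survives. A ring suffices, so
this applies to the center of the adjoint ring before it is known to be a field. -/
theorem card_commutator_heis_le [Finite R] :
    Nat.card (commutator (heis m R)) ≤ Nat.card R := by
  refine Nat.card_le_card_of_injective (fun g => heisCorner g.1) fun g h hgh => ?_
  have key : ∀ g : commutator (heis m R), heisRow g.1 = 0 ∧ heisCol g.1 = 0 := fun g =>
    Prod.mk.inj (MonoidHom.mem_ker.1 (Abelianization.commutator_subset_ker heisProj g.2))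
  apply Subtype.ext
  rw [← heisMk_eta g.1, ← heisMk_eta h.1, (key g).1, (key g).2, (key h).1, (key h).2]
  exact congrArg _ hgh

end Heis

/-! ### Symplectic coordinates and additive sections. -/

/-- Coordinates identifying `H` with `V × K`, where
`(u, s) (v, t) = (u + v, s + t + B(u, v) / 2)` for a nondegenerate alternating form `B`. -/
structure SymplecticCoordinates (H K V : Type u) [Group H] [Field K] [AddCommGroup V]
    [Module K V] where
  v : H → V
  t : H → K
  pt : V → K → H
  B : V →ₗ[K] V →ₗ[K] K
  v_pt : ∀ u s, v (pt u s) = u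
  t_pt : ∀ u s, t (pt u s) = s
  pt_eta : ∀ x, pt (v x) (t x) = x
  B_self : ∀ u, B u u = 0
  nondeg : ∀ u, (∀ w, B u w = 0) → u = 0
  v_mul : ∀ x y, v (x * y) = v x + v y
  t_mul : ∀ x y, t (x * y) = t x + t y + 2⁻¹ * B (v x) (v y)
  two_ne_zero : (2 : K) ≠ 0

/-- The standard symplectic form on `K^m × K^m`. -/
def stdForm (m : ℕ) (K : Type u) [Field K] :
    ((Fin m → K) × (Fin m → K)) →ₗ[K] ((Fin m → K) × (Fin m → K)) →ₗ[K] K :=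
  LinearMap.mk₂ K (fun p q => p.1 ⬝ᵥ q.2 - q.1 ⬝ᵥ p.2)
    (by intro p q r; simp; ring) (by intro c p q; simp; ring)
    (by intro p q r; simp; ring) (by intro c p q; simp; ring)

/-- Symplectic coordinates of a group isomorphic to `H_m(K)`. -/
def symplecticCoordinates {H K : Type u} [Group H] [Field K] (h2 : (2 : K) ≠ 0) {m : ℕ}
    (e : H ≃* heis m K) : SymplecticCoordinates H K ((Fin m → K) × (Fin m → K)) where
  v x := (heisRow (e x), heisCol (e x))
  -- This shift replaces the cocycle `x ⬝ᵥ y'` by half the alternating form.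
  t x := heisCorner (e x) - 2⁻¹ * (heisRow (e x) ⬝ᵥ heisCol (e x))
  pt u s := e.symm (heisMk u.1 u.2 (s + 2⁻¹ * (u.1 ⬝ᵥ u.2)))
  B := stdForm m K
  v_pt u s := by simp
  t_pt u s := by simp
  pt_eta x := by simp [heisMk_eta]
  B_self u := by simp [stdForm]
  nondeg := by
    intro u h
    refine Prod.ext (funext fun i => ?_) (funext fun i => ?_)
    · simpa [stdForm] using h (0, Pi.single i 1)
    · simpa [stdForm] using h (Pi.single i 1, 0)
  v_mul x y := by simp [heisRow_mul, heisCol_mul]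
  t_mul x y := by
    simp only [map_mul, heisRow_mul, heisCol_mul, heisCorner_mul, stdForm, LinearMap.mk₂_apply,
      add_dotProduct, dotProduct_add]
    field_simp
    ring
  two_ne_zero := h2

theorem exists_additive_section {p : ℕ} [Fact p.Prime] {A C : Type*} [AddCommGroup A]
    [AddCommGroup C] [Module (ZMod p) A] [Module (ZMod p) C] (f : A →+ C)
    (hf : Function.Surjective f) : ∃ g : C →+ A, ∀ q, f (g q) = q := by
  obtain ⟨g, hg⟩ := (f.toZModLinearMap p).exists_rightInverse_of_surjective
    (LinearMap.range_eq_top.2 hf)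
  exact ⟨g.toAddMonoidHom, fun q => LinearMap.congr_fun hg q⟩

/-- Both `K` and `K ⧸ N` are vector spaces over the prime field, where surjections split. -/
theorem exists_section_mk {K : Type u} [Field K] [Finite K] (N : AddSubgroup K) :
    ∃ g : K ⧸ N →+ K, ∀ q, (g q : K ⧸ N) = q := by
  have hp : Fact (ringChar K).Prime := ⟨CharP.char_is_prime K (ringChar K)⟩
  have h0 : ∀ x : K, ringChar K • x = 0 := fun x => by
    rw [nsmul_eq_mul, ringChar.Nat.cast_ringChar, zero_mul]
  let _ : Module (ZMod (ringChar K)) K := AddCommGroup.zmodModule h0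
  let _ : Module (ZMod (ringChar K)) (K ⧸ N) := AddCommGroup.zmodModule (by
    intro q
    induction q using QuotientAddGroup.induction_on with | H x => ?_
    rw [← QuotientAddGroup.mk_nsmul, h0, QuotientAddGroup.mk_zero])
  exact exists_additive_section (p := ringChar K) (QuotientAddGroup.mk' N)
    (QuotientAddGroup.mk'_surjective N)

theorem card_commutator_congr {G L : Type*} [Group G] [Group L] (e : G ≃* L) :
    Nat.card (commutator G) = Nat.card (commutator L) := by
  have hmap : (commutator G).map e.toMonoidHom = commutator L := by
    rw [commutator_def, Subgroup.map_commutator, commutator_def,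
      Subgroup.map_top_of_surjective _ e.surjective]
  rw [← hmap]
  exact Nat.card_congr (Subgroup.equivMapOfInjective _ e.toMonoidHom e.injective).toEquiv

/-! ### Commutators and central subgroups in coordinates. -/

namespace SymplecticCoordinates

variable {H K V : Type u} [Group H] [Field K] [AddCommGroup V] [Module K V]
  (C : SymplecticCoordinates H K V)

theorem ext {x y : H} (hv : C.v x = C.v y) (ht : C.t x = C.t y) : x = y := by
  rw [← C.pt_eta x, ← C.pt_eta y, hv, ht]

/-- The coordinate `v` as a homomorphism. -/
def vHom : H →* Multiplicative V :=
  MonoidHom.mk' (fun x => Multiplicative.ofAdd (C.v x)) (fun x y => by rw [C.v_mul]; rfl)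

theorem v_one : C.v 1 = 0 := map_one C.vHom

theorem v_inv (x : H) : C.v x⁻¹ = -C.v x := map_inv C.vHom x

theorem B_neg (u w : V) : C.B u w = -C.B w u := by
  have h := C.B_self (u + w)
  simp only [map_add, LinearMap.add_apply, C.B_self] at h
  linear_combination h

theorem t_one : C.t 1 = 0 := by
  have h := C.t_mul 1 1
  rw [mul_one, C.v_one, map_zero, mul_zero, add_zero] at h
  exact left_eq_add.1 h

theorem t_inv (x : H) : C.t x⁻¹ = -C.t x := by
  have h := C.t_mul x⁻¹ x
  rw [inv_mul_cancel, C.t_one, C.v_inv, map_neg, LinearMap.neg_apply, C.B_self] at h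
  linear_combination -h

theorem v_comm (x y : H) : C.v (x⁻¹ * y⁻¹ * x * y) = 0 := by
  simp only [C.v_mul, C.v_inv]
  abel

theorem t_comm (x y : H) : C.t (x⁻¹ * y⁻¹ * x * y) = C.B (C.v x) (C.v y) := by
  have h := C.two_ne_zero
  simp only [C.t_mul, C.t_inv, C.v_mul, C.v_inv, map_add, map_neg, LinearMap.add_apply,
    LinearMap.neg_apply, C.B_self]
  rw [C.B_neg (C.v y) (C.v x)]
  field_simp
  ring

theorem comm_eq_pt (x y : H) : x⁻¹ * y⁻¹ * x * y = C.pt 0 (C.B (C.v x) (C.v y)) :=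
  C.ext (by rw [C.v_comm, C.v_pt]) (by rw [C.t_comm, C.t_pt])

theorem v_eq_zero_of_mem_commutator {x : H} (hx : x ∈ commutator H) : C.v x = 0 :=
  MonoidHom.mem_ker.1 (Abelianization.commutator_subset_ker C.vHom hx)

theorem commute_of_v_eq_zero {x : H} (hx : C.v x = 0) (y : H) : x * y = y * x :=
  C.ext (by rw [C.v_mul, C.v_mul, add_comm])
    (by rw [C.t_mul, C.t_mul, hx, map_zero, map_zero, LinearMap.zero_apply, add_comm (C.t x)])

/-- The additive subgroup of `K` cut out by a subgroup of `H`. -/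
def trace (M : Subgroup H) : AddSubgroup K where
  carrier := {s | C.pt 0 s ∈ M}
  zero_mem' := by
    have : C.pt 0 0 = 1 := C.ext (by rw [C.v_pt, C.v_one]) (by rw [C.t_pt, C.t_one])
    change C.pt 0 0 ∈ M
    rw [this]
    exact M.one_mem
  add_mem' := by
    intro r s hr hs
    have : C.pt 0 (r + s) = C.pt 0 r * C.pt 0 s :=
      C.ext (by simp [C.v_mul, C.v_pt]) (by simp [C.t_mul, C.t_pt, C.v_pt])
    change C.pt 0 (r + s) ∈ M
    rw [this]
    exact M.mul_mem hr hs
  neg_mem' := by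
    intro r hr
    have : C.pt 0 (-r) = (C.pt 0 r)⁻¹ :=
      C.ext (by simp [C.v_inv, C.v_pt]) (by simp [C.t_inv, C.t_pt])
    change C.pt 0 (-r) ∈ M
    rw [this]
    exact M.inv_mem hr

theorem mem_trace {M : Subgroup H} {s : K} : s ∈ C.trace M ↔ C.pt 0 s ∈ M := Iff.rfl

theorem trace_ne_top {M : Subgroup H} (hM : M < commutator H) : C.trace M ≠ ⊤ := by
  obtain ⟨x, hx, hxM⟩ := SetLike.exists_of_lt hM
  intro h
  have : C.t x ∈ C.trace M := h ▸ AddSubgroup.mem_top _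
  rw [mem_trace, ← C.v_eq_zero_of_mem_commutator hx, C.pt_eta] at this
  exact hxM this

theorem exists_B_eq_one {M : Subgroup H} (hM : M < commutator H) : ∃ u a, C.B u a = 1 := by
  obtain ⟨x, hx, hxM⟩ := SetLike.exists_of_lt hM
  by_contra! hB
  have hB0 : ∀ u w, C.B u w = 0 := by
    intro u w
    by_contra h
    refine hB ((C.B u w)⁻¹ • u) w ?_
    rw [map_smul, LinearMap.smul_apply, smul_eq_mul, inv_mul_cancel₀ h]
  have hv : ∀ x, C.v x = 0 := fun x => C.nondeg _ (hB0 _)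
  have : commutator H = ⊥ := by
    rw [commutator_def, Subgroup.commutator_eq_bot_iff_le_centralizer]
    intro x _ y _
    exact (C.commute_of_v_eq_zero (hv y) x)
  rw [this] at hx
  exact hxM (Subgroup.mem_bot.1 hx ▸ M.one_mem)

theorem card_le_card_commutator [Finite H] {u a : V} (h1 : C.B u a = 1) :
    Nat.card K ≤ Nat.card (commutator H) := by
  have hmem : ∀ s : K, C.pt 0 s ∈ commutator H := by
    intro s
    -- Each central `s` is a single commutator, because `B (s • u) a = s`.
    have := C.comm_eq_pt (C.pt (s • u) 0) (C.pt a 0)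
    rw [C.v_pt, C.v_pt, map_smul, LinearMap.smul_apply, h1, smul_eq_mul, mul_one] at this
    rw [← this]
    exact comm_mem _ _
  refine Nat.card_le_card_of_injective (fun s => (⟨C.pt 0 s, hmem s⟩ : commutator H))
    fun r s h => ?_
  rw [← C.t_pt 0 r, ← C.t_pt 0 s]
  exact congrArg C.t (congrArg Subtype.val h)

/-! ### The commutation bimap of `H/M`. -/

section Quotient

variable {M : Subgroup H}

theorem mk_eq_mk (hM : M ≤ commutator H) (x y : H) :
    (x : H ⧸ M) = y ↔ C.v x = C.v y ∧ C.t y - C.t x ∈ C.trace M := by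
  rw [QuotientGroup.eq, mem_trace]
  have ht : C.v x = C.v y → C.t (x⁻¹ * y) = C.t y - C.t x := by
    intro h
    rw [C.t_mul, C.t_inv, C.v_inv, h, map_neg, LinearMap.neg_apply, C.B_self]
    ring
  constructor
  · intro h
    have hv := C.v_eq_zero_of_mem_commutator (hM h)
    have hxy : C.v x = C.v y := by
      rw [C.v_mul, C.v_inv] at hv
      exact neg_add_eq_zero.1 hv
    rw [← ht hxy, ← hv, C.pt_eta]
    exact ⟨hxy, h⟩
  · rintro ⟨hxy, h⟩
    have hv : C.v (x⁻¹ * y) = 0 := by rw [C.v_mul, C.v_inv, hxy, neg_add_cancel]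
    rwa [← ht hxy, ← hv, C.pt_eta] at h

theorem mk_comm_eq_mk_comm (hM : M ≤ commutator H) (x y x' y' : H) :
    ((x⁻¹ * y⁻¹ * x * y : H) : H ⧸ M) = (x'⁻¹ * y'⁻¹ * x' * y' : H) ↔
      C.B (C.v x) (C.v y) - C.B (C.v x') (C.v y') ∈ C.trace M := by
  rw [eq_comm, C.mk_eq_mk hM, C.v_comm, C.v_comm, C.t_comm, C.t_comm]
  simp

variable [M.Normal]

/-- If `x` is central mod `M`, all `K`-multiples of `B(v x, w)` lie in a proper additive subgroup,
so they vanish. -/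
theorem mk_mem_center_iff (hM : M < commutator H) (x : H) :
    (x : H ⧸ M) ∈ Subgroup.center (H ⧸ M) ↔ C.v x = 0 := by
  rw [Subgroup.mem_center_iff]
  constructor
  · intro h
    refine C.nondeg _ fun w => eq_zero_of_mul_mem (C.trace_ne_top hM) fun c => ?_
    have h2 : ((C.pt (c • w) 0 * x : H) : H ⧸ M) = (x * C.pt (c • w) 0 : H) := h (C.pt (c • w) 0 : H)
    have h3 := QuotientGroup.eq.1 h2
    rw [mul_inv_rev, ← mul_assoc, C.comm_eq_pt, C.v_pt, map_smul, smul_eq_mul] at h3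
    exact h3
  · intro h g
    induction g using QuotientGroup.induction_on with | H y => ?_
    rw [← QuotientGroup.mk_mul, ← QuotientGroup.mk_mul, C.commute_of_v_eq_zero h]

/-- The identification of `(H/M)/Z(H/M)` with `V`. -/
theorem exists_centralQuotientEquiv (hM : M < commutator H) [IsClassTwo (H ⧸ M)] :
    ∃ θ : GenHeis.V (H ⧸ M) ≃+ V, ∀ x : H,
      θ (Additive.ofMul ((x : H ⧸ M) : (H ⧸ M) ⧸ Subgroup.center (H ⧸ M))) = C.v x := by
  let f₁ : H ⧸ M →* Multiplicative V := QuotientGroup.lift M C.vHom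
    (fun x hx => MonoidHom.mem_ker.1 (Abelianization.commutator_subset_ker C.vHom (hM.le hx)))
  let f₂ : (H ⧸ M) ⧸ Subgroup.center (H ⧸ M) →* Multiplicative V :=
    QuotientGroup.lift _ f₁ (by
      intro g hg
      induction g using QuotientGroup.induction_on with | H x => ?_
      exact congrArg Multiplicative.ofAdd ((C.mk_mem_center_iff hM x).1 hg))
  let f : GenHeis.V (H ⧸ M) →+ V := AddMonoidHom.mk' (fun a => (f₂ a.toMul).toAdd)
    (fun a b => congrArg Multiplicative.toAdd (map_mul f₂ a.toMul b.toMul))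
  refine ⟨AddEquiv.ofBijective f ⟨(injective_iff_map_eq_zero f).2 fun a ha => ?_, fun u => ?_⟩,
    fun x => rfl⟩
  · induction a using Additive.rec with | ofMul a => ?_
    induction a using QuotientGroup.induction_on with | H g => ?_
    induction g using QuotientGroup.induction_on with | H x => ?_
    exact congrArg Additive.ofMul
      ((QuotientGroup.eq_one_iff _).2 ((C.mk_mem_center_iff hM x).2 ha))
  · exact ⟨Additive.ofMul ((C.pt u 0 : H ⧸ M) : (H ⧸ M) ⧸ Subgroup.center (H ⧸ M)), C.v_pt u 0⟩

theorem Bi_eq_zero {G : Type u} [Group G] [IsClassTwo G] (y : GenHeis.V G)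
    (h : ∀ x, Bi G x y = 0) : y = 0 := by
  induction y using Additive.rec with | ofMul y => ?_
  induction y using QuotientGroup.induction_on with | H y => ?_
  refine congrArg Additive.ofMul ((QuotientGroup.eq_one_iff _).2 (Subgroup.mem_center_iff.2 ?_))
  intro g
  have h2 : g⁻¹ * y⁻¹ * g * y = 1 :=
    congrArg (fun w : commutator G => (w : G)) (congrArg Additive.toMul
      (h (Additive.ofMul (g : G ⧸ Subgroup.center G))))
  calc g * y = y * g * (g⁻¹ * y⁻¹ * g * y) := by group
    _ = y * g := by rw [h2, mul_one]

/-- If `H/M` is indigenous, then adjoint pairs of `B mod M` are `K`-linear. -/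
theorem map_smul_of_isIndigenous [Finite H] [Finite K] (hM : M < commutator H)
    (hMi : IsIndigenous H M) {u₀ a₀ : V} (h1 : C.B u₀ a₀ = 1)
    (f g : V →+ V) (hfg : ∀ u v, C.B (f u) v - C.B u (g v) ∈ C.trace M) (c : K) (u : V) :
    f (c • u) = c • f u := by
  obtain ⟨_, m, -, ⟨e⟩⟩ := hMi
  obtain ⟨θ, hθ⟩ := C.exists_centralQuotientEquiv hM
  refine map_smul_of_card_adjCenter h1 (Bi (H ⧸ M)) Bi_eq_zero θ ?_ ?_ f g hfg c u
  · intro x y x' y'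
    have hex : ∀ a : GenHeis.V (H ⧸ M), ∃ x : H,
        Additive.ofMul ((x : H ⧸ M) : (H ⧸ M) ⧸ Subgroup.center (H ⧸ M)) = a := by
      intro a
      induction a using Additive.rec with | ofMul a => ?_
      induction a using QuotientGroup.induction_on with | H g => ?_
      induction g using QuotientGroup.induction_on with | H x => ?_
      exact ⟨x, rfl⟩
    obtain ⟨x, rfl⟩ := hex x
    obtain ⟨y, rfl⟩ := hex y
    obtain ⟨x', rfl⟩ := hex x'
    obtain ⟨y', rfl⟩ := hex y'
    rw [hθ, hθ, hθ, hθ, ← C.mk_comm_eq_mk_comm hM.le, Bi_mk, Bi_mk]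
    exact Additive.ofMul.injective.eq_iff.trans Subtype.ext_iff
  · intro _
    exact ((C.card_le_card_commutator h1).trans_eq (card_commutator_congr e)).trans
      card_commutator_heis_le

end Quotient

/-! ### Lifting isomorphisms of quotients. -/

section Isomorphism

variable {H K V : Type u} [Group H] [Field K] [AddCommGroup V] [Module K V]
  (C : SymplecticCoordinates H K V) {M N : Subgroup H} [M.Normal] [N.Normal]

/-- An isomorphism `H/M ≃ H/N` induces an additive automorphism of `V`. -/
theorem exists_addEquiv_of_quotient_equiv [Finite H] (hM : M < commutator H) (hN : N < commutator H)
    (φ : H ⧸ M ≃* H ⧸ N) :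
    ∃ P : V ≃+ V, ∀ x k : H, φ (x : H ⧸ M) = (k : H ⧸ N) → C.v k = P (C.v x) := by
  have hex : ∀ x : H, ∃ k : H, φ (x : H ⧸ M) = (k : H ⧸ N) := fun x =>
    (QuotientGroup.mk_surjective (φ x)).imp fun _ h => h.symm
  -- Centers correspond under `φ`, so `C.v k` depends only on `C.v x`.
  have hv0 : ∀ x k : H, φ (x : H ⧸ M) = (k : H ⧸ N) → (C.v k = 0 ↔ C.v x = 0) := by
    intro x k h
    rw [← C.mk_mem_center_iff hM x, ← C.mk_mem_center_iff hN k, ← h]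
    exact MulEquivClass.apply_mem_center_iff φ
  choose c hc using hex
  have key : ∀ x k : H, φ (x : H ⧸ M) = (k : H ⧸ N) → C.v k = C.v (c (C.pt (C.v x) 0)) := by
    intro x k h
    have := (hv0 (x * (C.pt (C.v x) 0)⁻¹) (k * (c (C.pt (C.v x) 0))⁻¹) (by
      rw [QuotientGroup.mk_mul, QuotientGroup.mk_inv, map_mul, map_inv, h, hc]
      rfl)).2 (by rw [C.v_mul, C.v_inv, C.v_pt, add_neg_cancel])
    rwa [C.v_mul, C.v_inv, add_neg_eq_zero] at this
  let f : V →+ V := AddMonoidHom.mk' (fun u => C.v (c (C.pt u 0))) (by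
    intro u w
    have := key (C.pt u 0 * C.pt w 0) (c (C.pt u 0) * c (C.pt w 0))
      (by rw [QuotientGroup.mk_mul, map_mul, hc, hc]; rfl)
    rw [C.v_mul, C.v_mul, C.v_pt, C.v_pt] at this
    exact this.symm)
  have hf : Function.Injective f := (injective_iff_map_eq_zero f).2 fun u hu => by
    rw [← C.v_pt u 0]
    exact (hv0 _ _ (hc _)).1 hu
  have : Finite V := Finite.of_surjective C.v fun u => ⟨C.pt u 0, C.v_pt u 0⟩
  exact ⟨AddEquiv.ofBijective f (Finite.injective_iff_bijective.1 hf), key⟩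

theorem trace_iff_of_quotient_equiv (hM : M < commutator H) (hN : N < commutator H)
    (φ : H ⧸ M ≃* H ⧸ N) (P : V ≃+ V)
    (hP : ∀ x k : H, φ (x : H ⧸ M) = (k : H ⧸ N) → C.v k = P (C.v x)) (u w u' w' : V) :
    C.B u w - C.B u' w' ∈ C.trace M ↔ C.B (P u) (P w) - C.B (P u') (P w') ∈ C.trace N := by
  have hex : ∀ u : V, ∃ x k : H, C.v x = u ∧ C.v k = P u ∧ φ (x : H ⧸ M) = (k : H ⧸ N) := by
    intro u
    obtain ⟨k, hk⟩ := QuotientGroup.mk_surjective (φ (C.pt u 0 : H))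
    exact ⟨C.pt u 0, k, C.v_pt _ _, by rw [hP _ k hk.symm, C.v_pt], hk.symm⟩
  have hcomm : ∀ x y k l : H, φ (x : H ⧸ M) = (k : H ⧸ N) → φ (y : H ⧸ M) = (l : H ⧸ N) →
      φ ((x⁻¹ * y⁻¹ * x * y : H) : H ⧸ M) = ((k⁻¹ * l⁻¹ * k * l : H) : H ⧸ N) := by
    intro x y k l hx hy
    simp only [QuotientGroup.mk_mul, QuotientGroup.mk_inv, map_mul, map_inv, hx, hy]
  obtain ⟨x₁, k₁, rfl, hk₁, h₁⟩ := hex u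
  obtain ⟨x₂, k₂, rfl, hk₂, h₂⟩ := hex w
  obtain ⟨x₃, k₃, rfl, hk₃, h₃⟩ := hex u'
  obtain ⟨x₄, k₄, rfl, hk₄, h₄⟩ := hex w'
  rw [← hk₁, ← hk₂, ← hk₃, ← hk₄, ← C.mk_comm_eq_mk_comm hM.le, ← C.mk_comm_eq_mk_comm hN.le,
    ← hcomm _ _ _ _ h₁ h₂, ← hcomm _ _ _ _ h₃ h₄, φ.injective.eq_iff]

/-- An isomorphism `H/M ≃ H/N` inducing a semisimilarity on `V` lifts to an automorphism of `H`. -/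
theorem exists_lift_of_semisimilarity [Finite H] [Finite K] (hN : N < commutator H)
    (φ : H ⧸ M ≃* H ⧸ N) (P : V ≃+ V)
    (hP : ∀ x k : H, φ (x : H ⧸ M) = (k : H ⧸ N) → C.v k = P (C.v x)) {u₀ a₀ : V}
    (h1 : C.B u₀ a₀ = 1) (σ : K →+* K) {l : K} (hl : l ≠ 0)
    (hσ : ∀ u w, C.B (P u) (P w) = l * σ (C.B u w)) :
    ∃ Φ : H ≃* H, ∀ x : H, φ (x : H ⧸ M) = (Φ x : H ⧸ N) := by
  have hex : ∀ x : H, ∃ k : H, φ (x : H ⧸ M) = (k : H ⧸ N) := fun x =>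
    (QuotientGroup.mk_surjective (φ x)).imp fun _ h => h.symm
  choose c hc using hex
  have huniq : ∀ x k k' : H, φ (x : H ⧸ M) = (k : H ⧸ N) → φ (x : H ⧸ M) = (k' : H ⧸ N) →
      (C.t k : K ⧸ C.trace N) = C.t k' := by
    intro x k k' h h'
    rw [QuotientAddGroup.eq, neg_add_eq_sub]
    exact ((C.mk_eq_mk hN.le k k').1 (h.symm.trans h')).2
  have hcen : ∀ (s : K) (k : H), φ (C.pt 0 s : H) = (k : H ⧸ N) →
      (C.t k : K ⧸ C.trace N) = (l * σ s : K) := by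
    intro s k hk
    -- Writing the central element as a commutator makes its image computable from `P`.
    have hpt := C.comm_eq_pt (C.pt (s • u₀) 0) (C.pt a₀ 0)
    rw [C.v_pt, C.v_pt, map_smul, LinearMap.smul_apply, h1, smul_eq_mul, mul_one] at hpt
    rw [huniq _ k ((c (C.pt (s • u₀) 0))⁻¹ * (c (C.pt a₀ 0))⁻¹ * c (C.pt (s • u₀) 0) *
      c (C.pt a₀ 0)) hk (by
        simp only [← hpt, QuotientGroup.mk_mul, QuotientGroup.mk_inv, map_mul, map_inv, hc]),
      C.t_comm, hP _ _ (hc _), hP _ _ (hc _), C.v_pt, C.v_pt, hσ, map_smul, LinearMap.smul_apply,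
      h1, smul_eq_mul, mul_one]
  have key : ∀ x k : H, φ (x : H ⧸ M) = (k : H ⧸ N) →
      (C.t k : K ⧸ C.trace N) = (l * σ (C.t x) : K) + (C.t (c (C.pt (C.v x) 0)) : K ⧸ C.trace N) := by
    intro x k h
    have hx : x = C.pt 0 (C.t x) * C.pt (C.v x) 0 :=
      C.ext (by simp [C.v_mul, C.v_pt]) (by simp [C.t_mul, C.t_pt, C.v_pt])
    rw [huniq x k (c (C.pt 0 (C.t x)) * c (C.pt (C.v x) 0)) h (by
      rw [QuotientGroup.mk_mul, ← hc, ← hc, ← map_mul, ← QuotientGroup.mk_mul, ← hx]), C.t_mul,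
      hP _ _ (hc (C.pt 0 (C.t x))), C.v_pt, map_zero, map_zero, LinearMap.zero_apply, mul_zero,
      add_zero, QuotientAddGroup.mk_add, hcen _ _ (hc _)]
  -- Additive because the half-form terms on both sides agree: `P` is a semisimilarity and `σ` fixes
  -- `2⁻¹`.
  let τ : V →+ K ⧸ C.trace N := AddMonoidHom.mk' (fun u => (C.t (c (C.pt u 0)) : K ⧸ C.trace N)) (by
    intro u w
    have h := key (C.pt u 0 * C.pt w 0) (c (C.pt u 0) * c (C.pt w 0))
      (by rw [QuotientGroup.mk_mul, map_mul, hc, hc]; rfl)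
    simp only [C.t_mul, C.v_mul, C.v_pt, C.t_pt, hP _ _ (hc _), hσ, zero_add, map_mul, map_inv₀,
      map_ofNat, QuotientAddGroup.mk_add] at h
    rw [mul_left_comm, add_comm] at h
    exact (add_left_cancel h).symm)
  obtain ⟨g, hg⟩ := exists_section_mk (C.trace N)
  let F : H →* H := MonoidHom.mk' (fun x => C.pt (P (C.v x)) (l * σ (C.t x) + g (τ (C.v x)))) (by
    intro x y
    refine C.ext ?_ ?_
    · simp [C.v_mul, C.v_pt]
    · simp only [C.t_mul, C.v_mul, C.v_pt, C.t_pt, hσ, map_add, map_mul, map_inv₀, map_ofNat]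
      ring)
  have hF : Function.Injective F := by
    intro x y hxy
    have hv : C.v x = C.v y := by
      have := congrArg C.v hxy
      simpa [F, C.v_pt] using this
    refine C.ext hv ?_
    have := congrArg C.t hxy
    exact σ.injective (by simpa [F, C.t_pt, hv, hl] using this)
  refine ⟨MulEquiv.ofBijective F (Finite.injective_iff_bijective.1 hF), fun x => ?_⟩
  rw [hc x]
  refine (C.mk_eq_mk hN.le _ _).2 ⟨(hP _ _ (hc x)).trans (C.v_pt _ _).symm, ?_⟩
  rw [← neg_add_eq_sub, ← QuotientAddGroup.eq, key x _ (hc x)]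
  change _ = ((C.t (C.pt _ _) : K) : K ⧸ C.trace N)
  rw [C.t_pt, QuotientAddGroup.mk_add, hg]
  rfl

end Isomorphism

end SymplecticCoordinates

/-! ### Odd characteristic and the conclusion. -/

/-- The additive group of `K` embeds through the corner entry, so `|K|` divides the odd number
`|H|`. -/
theorem two_ne_zero_of_odd_card {H K : Type u} [Group H] [Field K] [Finite K] {m : ℕ}
    (hodd : Odd (Nat.card H)) (e : H ≃* heis m K) : (2 : K) ≠ 0 := by
  intro h2
  let i : Multiplicative K →* heis m K := MonoidHom.mk' (fun s => heisMk 0 0 s.toAdd) (by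
    intro r s
    rw [heisMk_mul]
    simp)
  have hi : Function.Injective i := fun r s h => congrArg heisCorner h
  have hdvd : Nat.card K ∣ Nat.card H := by
    rw [Nat.card_congr e.toEquiv]
    exact (Nat.card_congr Multiplicative.ofAdd).dvd.trans (Subgroup.card_dvd_of_injective i hi)
  have h1 : addOrderOf (1 : K) = 2 :=
    addOrderOf_eq_prime (by rw [two_nsmul, one_add_one_eq_two, h2]) one_ne_zero
  have : 2 ∣ Nat.card K := h1 ▸ addOrderOf_dvd_natCard (1 : K)
  exact (Nat.not_even_iff_odd.2 hodd) (even_iff_two_dvd.2 (this.trans hdvd))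

end GenHeis

theorem mainTheorem5 (H : Type*) [Group H] (hH : GenHeis.IsGenHeisenberg H)
    (hodd : Odd (Nat.card H)) (M N : Subgroup H) [M.Normal] [N.Normal]
    (hM : M < commutator H) (hN : N < commutator H)
    (hMi : GenHeis.IsIndigenous H M) (hNi : GenHeis.IsIndigenous H N)
    (φ : H ⧸ M ≃* H ⧸ N) :
    ∃ Φ : H ≃* H, M.map Φ.toMonoidHom = N ∧
      ∀ x : H, φ (x : H ⧸ M) = (Φ x : H ⧸ N) := by
  obtain ⟨K, _, m, ⟨e⟩⟩ := hH
  have : Finite H := Nat.finite_of_card_ne_zero hodd.pos.ne'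
  have : Finite K := Finite.of_injective (fun s => e.symm (GenHeis.heisMk 0 0 s)) fun r s h =>
    congrArg GenHeis.heisCorner (e.symm.injective h)
  let C := GenHeis.symplecticCoordinates (GenHeis.two_ne_zero_of_odd_card hodd e) e
  obtain ⟨u₀, a₀, h1⟩ := C.exists_B_eq_one hM
  obtain ⟨P, hP⟩ := C.exists_addEquiv_of_quotient_equiv hM hN φ
  obtain ⟨σ, l, hl, hσ⟩ := GenHeis.exists_semisimilarity h1 (C.trace_ne_top hN)
    (C.map_smul_of_isIndigenous hM hMi h1) P (C.trace_iff_of_quotient_equiv hM hN φ P hP)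
  obtain ⟨Φ, hΦ⟩ := C.exists_lift_of_semisimilarity hN φ P hP h1 σ hl hσ
  have hmem : ∀ x, x ∈ M ↔ Φ x ∈ N := fun x => by
    rw [← QuotientGroup.eq_one_iff, ← QuotientGroup.eq_one_iff, ← hΦ, map_eq_one_iff φ φ.injective]
  refine ⟨Φ, ?_, hΦ⟩
  ext y
  refine ⟨?_, fun hy => ⟨Φ.symm y, (hmem _).2 (by rwa [Φ.apply_symm_apply]), Φ.apply_symm_apply y⟩⟩
  rintro ⟨x, hx, rfl⟩
  exact (hmem x).1 hx
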